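/- Let $G=(\mathcal V,\mathcal A)$ be a finite directed graph (parallel arcs and loops allowed) with a set $\mathcal A_1\subseteq\mathcal A$ of tolled arcs, real base costs $(c_a)_{a\in\mathcal A}$ with $c_a\ge 0$ for every toll-free arc $a\notin\mathcal A_1$, an origin $o$ and a destination $d$. Suppose that $G$ contains a path from $o$ to $d$ that uses no tolled arc. Let $M$ be the vertex-arc incidence matrix of $G$ ($+1$ at the tail and $-1$ at the head of each arc), let $b=e_o-e_d$, and let $$\mathcal X=\{x\in\mathbb R^{\mathcal A}\mid Mx=b,\ x\ge 0\}$$ be the follower's feasible polyhedron. For $x\in\mathcal X$ let $x_{\mathcal A_1}\in\mathbb R^{\mathcal A_1}$ be its restriction to the tolled arcs. For $t\in\mathbb R^{\mathcal A_1}$ with $t\ge 0$ let $$f(t)=\inf\{c^{\top}x+t^{\top}w \mid x\in\mathcal X,\ w\in\mathbb R^{\mathcal A_1},\ w\ge 0,\ x_{\mathcal A_1}\le w\},$$ and let $f(t)=-\infty$ if $t\not\ge 0$. Let $g(w)=\sup_{t}\{f(t)-t^{\top}w\}$ for $w\in\mathbb R^{\mathcal A_1}$. A point $x\in\mathcal X$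 is *bilevel feasible* if the hyperplane $\{(t,z)\mid z=-c^{\top}x-t^{\top}x_{\mathcal A_1}\}$ supports $\operatorname{epi}(-f)$, i.e. $\operatorname{epi}(-f)\subseteq\{(t,z)\mid z\ge -c^{\top}x-t^{\top}x_{\mathcal A_1}\}$ and the hyperplane meets $\operatorname{epi}(-f)$. A *reaction set* is the projection to $\mathbb R^{\mathcal A_1}$ of a non-vertical face of $\operatorname{epi}(g)\subseteq\mathbb R^{\mathcal A_1}\times\mathbb R$; a face is a nonempty set of maximizers of a linear functional over $\operatorname{epi}(g)$, and it is non-vertical if the direction $(0,1)$ is not parallel to its affine hull. A vector $w\in\mathbb R^{\mathcal A_1}$ is *strongly bilevel feasible* if $\{w\}$ is a reaction set. **Proposition.** If $w$ is strongly bilevel feasible, then there is an extreme point $x$ of $\mathcal X$ that is the indicator vector of the arc set of a simple path from $o$ to $d$, is bilevel feasible, and satisfies $x_{\mathcal A_1}=w$. Consequently, every strongly bilevel feasible $w$ is binary, that is, $w\in\{0,1\}^{\mathcal A_1}$. -/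

import Mathlib

open scoped Matrix

noncomputable section

/-- The data of a single-commodity network pricing problem on a directed graph with vertex type `V`
and arc type `A`: the endpoints of the arcs, the set of tolled arcs, the base costs, and the
follower's origin and destination. Parallel arcs and loops are allowed. -/
structure TollNetwork (V A : Type*) where
  tail : A → V
  head : A → V
  tolled : Finset A
  cost : A → ℝ
  origin : V
  dest : V

namespace TollNetwork

/-- The type of tolled arcs. -/
abbrev Tolled {V A : Type*} (N : TollNetwork V A) : Type _ := {a : A // a ∈ N.tolled}

/-- `N.IsWalk u p v`: the list of arcs `p` is a directed walk from `u` to `v`. -/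
def IsWalk {V A : Type*} (N : TollNetwork V A) : V → List A → V → Prop
  | u, [], v => u = v
  | u, a :: p, v => N.tail a = u ∧ N.IsWalk (N.head a) p v

/-- There is a walk from the origin to the destination that uses no tolled arc. -/
def HasTollFreePath {V A : Type*} (N : TollNetwork V A) : Prop :=
  ∃ p : List A, N.IsWalk N.origin p N.dest ∧ ∀ a ∈ p, a ∉ N.tolled

/-- `x` is the indicator vector of the arc set of a simple path (one that repeats no vertex) from
the origin to the destination. -/
def IsSimplePath {V A : Type*} [DecidableEq A] (N : TollNetwork V A) (x : A → ℝ) : Prop :=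
  ∃ p : List A, N.IsWalk N.origin p N.dest ∧ (N.origin :: p.map N.head).Nodup ∧
    ∀ a, x a = if a ∈ p then 1 else 0

/-- The vertex-arc incidence matrix: `+1` at the tail of an arc, `-1` at its head. -/
def incidence {V A : Type*} [DecidableEq V] (N : TollNetwork V A) : Matrix V A ℝ :=
  Matrix.of fun v a => (if N.tail a = v then 1 else 0) - (if N.head a = v then 1 else 0)

/-- The source-sink vector. -/
def sourceSink {V A : Type*} [DecidableEq V] (N : TollNetwork V A) : V → ℝ :=
  Pi.single N.origin 1 - Pi.single N.dest 1

/-- The follower's feasible polyhedron `{x | M x = b, x ≥ 0}` with `M` the incidence matrix. -/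
def feasible {V A : Type*} [DecidableEq V] [Fintype A] (N : TollNetwork V A) : Set (A → ℝ) :=
  {x | N.incidence *ᵥ x = N.sourceSink ∧ 0 ≤ x}

/-- The reduced reaction: the restriction of `x` to the tolled arcs. -/
def reduced {V A : Type*} (N : TollNetwork V A) (x : A → ℝ) : N.Tolled → ℝ :=
  fun a => x a

/-- The follower's optimal cost `f`. For `t ≥ 0` it is the optimal value of
`min {cᵀ x + tᵀ w | x_{A₁} ≤ w, M x = b, w ≥ 0, x ≥ 0}`; otherwise it is `-∞`. -/
def followerCost {V A : Type*} [DecidableEq V] [Fintype A] (N : TollNetwork V A)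
    (t : N.Tolled → ℝ) : EReal :=
  open Classical in
  if 0 ≤ t then
    ⨅ (w : N.Tolled → ℝ) (x : A → ℝ) (_ : x ∈ N.feasible ∧ 0 ≤ w ∧ N.reduced x ≤ w),
      ((N.cost ⬝ᵥ x + t ⬝ᵥ w : ℝ) : EReal)
  else ⊥

/-- The conjugate `g(w) = sup_t {f(t) - tᵀ w}`. -/
def conjugateCost {V A : Type*} [DecidableEq V] [Fintype A] (N : TollNetwork V A)
    (w : N.Tolled → ℝ) : EReal :=
  ⨆ t : N.Tolled → ℝ, N.followerCost t - ((t ⬝ᵥ w : ℝ) : EReal)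

/-- The epigraph in `E × ℝ` of an extended-real-valued function. -/
def epi {E : Type*} (h : E → EReal) : Set (E × ℝ) :=
  {p | h p.1 ≤ (p.2 : EReal)}

/-- The closed half-space `H(g, w) = {(t, z) | z ≥ -g - tᵀ w}`. -/
def halfSpace {V A : Type*} (N : TollNetwork V A) (g : ℝ) (w : N.Tolled → ℝ) :
    Set ((N.Tolled → ℝ) × ℝ) :=
  {p | -g - p.1 ⬝ᵥ w ≤ p.2}

/-- The hyperplane `H₌(g, w) = {(t, z) | z = -g - tᵀ w}` that bounds `H(g, w)`. -/
def hyperplane {V A : Type*} (N : TollNetwork V A) (g : ℝ) (w : N.Tolled → ℝ) :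
    Set ((N.Tolled → ℝ) × ℝ) :=
  {p | p.2 = -g - p.1 ⬝ᵥ w}

/-- A reaction `x` is bilevel feasible when the hyperplane `H₌(cᵀ x, x_{A₁})` supports `epi (-f)`:
the epigraph lies in the half-space `H(cᵀ x, x_{A₁})` and meets the hyperplane. -/
def BilevelFeasible {V A : Type*} [DecidableEq V] [Fintype A] (N : TollNetwork V A)
    (x : A → ℝ) : Prop :=
  x ∈ N.feasible ∧
  epi (fun t => -N.followerCost t) ⊆ N.halfSpace (N.cost ⬝ᵥ x) (N.reduced x) ∧
  (epi (fun t => -N.followerCost t) ∩ N.hyperplane (N.cost ⬝ᵥ x) (N.reduced x)).Nonempty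

/-- A (nonempty) face of a polyhedron: the set of maximizers over it of some linear functional. -/
def IsFace {E : Type*} [AddCommGroup E] [Module ℝ E] [TopologicalSpace E] (P F : Set E) : Prop :=
  F.Nonempty ∧ IsExposed ℝ P F

/-- A reaction set is the projection to the `w`-space of a non-vertical face of `epi g`, that is, of
a face whose affine hull does not contain the direction `(0, 1)`. -/
def IsReactionSet {V A : Type*} [DecidableEq V] [Fintype A] (N : TollNetwork V A)
    (W : Set (N.Tolled → ℝ)) : Prop :=
  ∃ F : Set ((N.Tolled → ℝ) × ℝ), IsFace (epi N.conjugateCost) F ∧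
    ((0, 1) : (N.Tolled → ℝ) × ℝ) ∉ (affineSpan ℝ F).direction ∧
    W = {w | ∃ z : ℝ, (w, z) ∈ F}

/-- A reduced reaction `w` is strongly bilevel feasible when `{w}` is a reaction set. -/
def StronglyBilevelFeasible {V A : Type*} [DecidableEq V] [Fintype A] (N : TollNetwork V A)
    (w : N.Tolled → ℝ) : Prop :=
  N.IsReactionSet {w}

end TollNetwork

end

/-!
A singleton reaction set `{w}` comes from a functional `l` that is maximal over `epi g` exactly on a
non-vertical face lying above `w`. Since `epi g` is closed under increasing `z` and under increasing
`w`, and the face is not vertical, `l` is a positive multiple of `(w, z) ↦ -(z + τᵀ w)` for some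
toll vector `τ ≥ 0`.

Every `x ∈ X` gives the point `(x_{A₁}, cᵀ x)` of `epi g`, so the cost vector `q = c + τ` (tolls
added on the tolled arcs) is bounded below on `X`. A linear program on `X` that is bounded below is
solved by a simple path (`exists_simplePath_isMin`): boundedness makes all circulations, hence all
closed walks, have nonnegative cost, so there is a vertex potential given by shortest walks, and the
potential bounds the cost of every `x ∈ X` below by that of a cheapest simple path. Let `x` be the
indicator vector of this path. Then `f τ = qᵀ x`, and by definition of the conjugate
`z' + τᵀ w' ≥ f τ` on all of `epi g`, with equality at `(x_{A₁}, cᵀ x)`. So this point lies in the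
face, and `x_{A₁} = w`. The hyperplane of `x` meets `epi (-f)` above `τ`, so `x` is bilevel
feasible. No strong duality between `f` and `g` enters.

Finally, the indicator vector of a simple path is an extreme point of `X`
(`indicator_mem_extremePoints`) because no nonzero circulation is supported on a simple path.
-/

namespace TollNetwork

variable {V A : Type*}

/-! ### Walks and their arc multiplicities -/

theorem IsWalk.append {N : TollNetwork V A} {p r : List A} {u v y : V}
    (hp : N.IsWalk u p v) (hr : N.IsWalk v r y) : N.IsWalk u (p ++ r) y := by
  induction p generalizing u with
  | nil => cases hp; exact hr
  | cons a p ih => exact ⟨hp.1, ih hp.2⟩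

theorem IsWalk.exists_of_append {N : TollNetwork V A} {p r : List A} {u y : V}
    (h : N.IsWalk u (p ++ r) y) : ∃ v, N.IsWalk u p v ∧ N.IsWalk v r y := by
  induction p generalizing u with
  | nil => exact ⟨u, rfl, h⟩
  | cons a p ih =>
    obtain ⟨v, h1, h2⟩ := ih h.2
    exact ⟨v, ⟨h.1, h1⟩, h2⟩

theorem IsWalk.tail_mem {N : TollNetwork V A} {p : List A} {u v : V}
    (h : N.IsWalk u p v) {a : A} (ha : a ∈ p) : N.tail a ∈ u :: p.map N.head := by
  induction p generalizing u with
  | nil => cases ha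
  | cons b p ih =>
    rcases List.mem_cons.1 ha with rfl | ha
    · rw [h.1]; exact List.mem_cons_self
    · exact List.mem_cons_of_mem _ (ih h.2 ha)

/-- A walk can be cut at any vertex that it visits. -/
theorem IsWalk.exists_split {N : TollNetwork V A} {p : List A} {u v y : V}
    (h : N.IsWalk u p v) (hy : y ∈ u :: p.map N.head) :
    ∃ p₁ p₂, p = p₁ ++ p₂ ∧ N.IsWalk u p₁ y ∧ N.IsWalk y p₂ v := by
  rcases List.mem_cons.1 hy with rfl | hy
  · exact ⟨[], p, rfl, rfl, h⟩
  · obtain ⟨a, ha, rfl⟩ := List.mem_map.1 hy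
    obtain ⟨s, r, rfl⟩ := List.append_of_mem ha
    obtain ⟨v', h1, h2⟩ := h.exists_of_append
    exact ⟨s ++ [a], r, by simp, h1.append ⟨h2.1, rfl⟩, h2.2⟩

/-- The flow of a walk: every arc carries the number of times that the walk traverses it. -/
noncomputable def walkFlow [DecidableEq A] (p : List A) : A → ℝ :=
  fun a => (p.count a : ℝ)

theorem walkFlow_nonneg [DecidableEq A] (p : List A) : 0 ≤ walkFlow p :=
  fun _ => Nat.cast_nonneg _

theorem walkFlow_cons [DecidableEq A] (a : A) (p : List A) :
    walkFlow (a :: p) = Pi.single a 1 + walkFlow p := by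
  ext b
  by_cases h : a = b
  · subst h; simp [walkFlow, add_comm]
  · simp [walkFlow, h, Ne.symm h]

theorem walkFlow_of_nodup [DecidableEq A] {p : List A} (hp : p.Nodup) (a : A) :
    walkFlow p a = if a ∈ p then 1 else 0 := by
  simp [walkFlow, hp.count]

theorem dotProduct_walkFlow [DecidableEq A] [Fintype A] (q : A → ℝ) (p : List A) :
    q ⬝ᵥ walkFlow p = (p.map q).sum := by
  induction p with
  | nil =>
    have : walkFlow ([] : List A) = 0 := by ext; simp [walkFlow]
    simp [this]
  | cons a p ih => simp [walkFlow_cons, dotProduct_add, ih]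

variable [DecidableEq V]

theorem incidence_mulVec_single [DecidableEq A] [Fintype A] (N : TollNetwork V A) (a : A) :
    N.incidence *ᵥ Pi.single a 1 = Pi.single (N.tail a) 1 - Pi.single (N.head a) 1 := by
  ext v
  simp [incidence, Pi.single_apply, eq_comm]

theorem IsWalk.incidence_mulVec [DecidableEq A] [Fintype A] {N : TollNetwork V A} {p : List A}
    {u v : V} (h : N.IsWalk u p v) :
    N.incidence *ᵥ walkFlow p = Pi.single u 1 - Pi.single v 1 := by
  induction p generalizing u with
  | nil =>
    have : walkFlow ([] : List A) = 0 := by ext; simp [walkFlow]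
    cases h; simp [this]
  | cons a p ih =>
    rw [walkFlow_cons, Matrix.mulVec_add, ih h.2, incidence_mulVec_single, h.1]
    abel

theorem IsWalk.walkFlow_mem_feasible [DecidableEq A] [Fintype A] {N : TollNetwork V A}
    {p : List A} (h : N.IsWalk N.origin p N.dest) : walkFlow p ∈ N.feasible :=
  ⟨h.incidence_mulVec, walkFlow_nonneg p⟩

/-! ### Cheapest simple paths and potentials -/

/-- If closed walks have nonnegative cost, cutting them out of a walk leaves a simple walk that
costs no more. -/
theorem IsWalk.exists_simple_le {N : TollNetwork V A} {q : A → ℝ}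
    (hq : ∀ u p, N.IsWalk u p u → 0 ≤ (p.map q).sum) {p : List A} {u v : V}
    (h : N.IsWalk u p v) :
    ∃ r, N.IsWalk u r v ∧ (u :: r.map N.head).Nodup ∧ (r.map q).sum ≤ (p.map q).sum := by
  induction p generalizing u with
  | nil => exact ⟨[], h, by simp, le_rfl⟩
  | cons a p ih =>
    obtain ⟨r, hr, hnd, hle⟩ := ih h.2
    by_cases hu : u ∈ N.head a :: r.map N.head
    · obtain ⟨r₁, r₂, rfl, h1, h2⟩ := hr.exists_split hu
      refine ⟨r₂, h2, ?_, ?_⟩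
      · rcases List.eq_nil_or_concat r₁ with rfl | ⟨s, b, rfl⟩
        · cases h1; simpa using hnd
        · have hb : N.head b = u := by
            obtain ⟨v', -, h4⟩ := (List.concat_eq_append ▸ h1).exists_of_append
            exact h4.2
          have : List.Sublist (u :: r₂.map N.head)
              (N.head a :: (s.concat b ++ r₂).map N.head) := by
            simp [List.concat_eq_append, hb]
          exact hnd.sublist this
      · have := hq u (a :: r₁) ⟨h.1, h1⟩
        simp only [List.map_append, List.sum_append, List.map_cons, List.sum_cons] at this hle ⊢
        linarith
    · refine ⟨a :: r, ⟨h.1, hr⟩, ?_, ?_⟩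
      · rw [List.map_cons, List.nodup_cons]; exact ⟨hu, hnd⟩
      · simp only [List.map_cons, List.sum_cons]; linarith

omit [DecidableEq V] in
theorem nodup_of_nodup_heads {N : TollNetwork V A} {u : V} {p : List A}
    (h : (u :: p.map N.head).Nodup) : p.Nodup :=
  List.Nodup.of_map _ (List.nodup_cons.1 h).2

theorem neg_sum_abs_le_of_nodup [DecidableEq A] [Fintype A] (q : A → ℝ) {p : List A}
    (hp : p.Nodup) : -∑ a, |q a| ≤ (p.map q).sum := by
  rw [← List.sum_toFinset _ hp]
  calc -∑ a, |q a| ≤ -∑ a ∈ p.toFinset, |q a| :=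
        neg_le_neg (Finset.sum_le_sum_of_subset_of_nonneg (Finset.subset_univ _)
          fun _ _ _ => abs_nonneg _)
    _ = ∑ a ∈ p.toFinset, -|q a| := by rw [Finset.sum_neg_distrib]
    _ ≤ _ := Finset.sum_le_sum fun a _ => neg_abs_le _

/-- Weak duality: the reduced costs `q a + π (tail a) - π (head a)` of a potential are
nonnegative, and so is their product with a feasible flow. -/
theorem potential_le_dotProduct [Fintype V] [Fintype A] {N : TollNetwork V A} {q : A → ℝ}
    {π : V → ℝ} (hπ : ∀ a, π (N.head a) ≤ π (N.tail a) + q a) {x : A → ℝ}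
    (hx : x ∈ N.feasible) : π N.dest - π N.origin ≤ q ⬝ᵥ x := by
  have h1 : π ⬝ᵥ (N.incidence *ᵥ x) = π N.origin - π N.dest := by
    rw [hx.1]; simp [sourceSink, dotProduct_sub]
  have h2 : π ⬝ᵥ (N.incidence *ᵥ x) = ∑ a, (π (N.tail a) - π (N.head a)) * x a := by
    rw [Matrix.dotProduct_mulVec]
    refine Finset.sum_congr rfl fun a _ => ?_
    simp [Matrix.vecMul, dotProduct, incidence, mul_sub, Finset.sum_sub_distrib]
  have h3 : ∑ a, -((π (N.tail a) - π (N.head a)) * x a) ≤ ∑ a, q a * x a :=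
    Finset.sum_le_sum fun a _ => by
      have := mul_le_mul_of_nonneg_right (hπ a) (hx.2 a)
      nlinarith
  rw [Finset.sum_neg_distrib] at h3
  simp only [dotProduct] at *
  linarith

/-- A cost vector that is bounded below on the feasible flows has nonnegative cost on closed walks:
a closed walk of negative cost could be repeated on top of a feasible flow. -/
theorem closedWalk_cost_nonneg [DecidableEq A] [Fintype A] {N : TollNetwork V A} {q : A → ℝ}
    {K : ℝ} (hK : ∀ x ∈ N.feasible, K ≤ q ⬝ᵥ x) (hne : N.feasible.Nonempty) (u : V)
    (p : List A) (hp : N.IsWalk u p u) : 0 ≤ (p.map q).sum := by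
  obtain ⟨x, hx⟩ := hne
  by_contra! hneg
  obtain ⟨n, hn⟩ := exists_nat_gt ((q ⬝ᵥ x - K) / -(p.map q).sum)
  rw [div_lt_iff₀ (by linarith)] at hn
  have hmem : x + (n : ℝ) • walkFlow p ∈ N.feasible := by
    refine ⟨?_, add_nonneg hx.2 (smul_nonneg n.cast_nonneg (walkFlow_nonneg p))⟩
    rw [Matrix.mulVec_add, Matrix.mulVec_smul, hp.incidence_mulVec, hx.1]
    simp
  have := hK _ hmem
  rw [dotProduct_add, dotProduct_smul, dotProduct_walkFlow, smul_eq_mul] at this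
  linarith

/-- A linear program over the feasible flows that is bounded below is solved by a simple path. -/
theorem exists_simplePath_isMin [Fintype V] [DecidableEq A] [Fintype A] {N : TollNetwork V A}
    {q : A → ℝ} {K : ℝ} (hK : ∀ x ∈ N.feasible, K ≤ q ⬝ᵥ x)
    {p₀ : List A} (hp₀ : N.IsWalk N.origin p₀ N.dest) :
    ∃ p, N.IsWalk N.origin p N.dest ∧ (N.origin :: p.map N.head).Nodup ∧
      ∀ x ∈ N.feasible, q ⬝ᵥ walkFlow p ≤ q ⬝ᵥ x := by
  have hcyc := closedWalk_cost_nonneg hK ⟨_, hp₀.walkFlow_mem_feasible⟩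
  let S : Set (List A) := {p | N.IsWalk N.origin p N.dest ∧ (N.origin :: p.map N.head).Nodup}
  have hfin : S.Finite := by
    refine (List.finite_length_le A (Fintype.card A)).subset fun p hp => ?_
    exact (nodup_of_nodup_heads hp.2).length_le_card
  have hSne : S.Nonempty := by
    obtain ⟨r, h1, h2, -⟩ := hp₀.exists_simple_le hcyc
    exact ⟨r, h1, h2⟩
  obtain ⟨p, ⟨hp, hnd⟩, hmin⟩ := Set.exists_min_image S (fun p => (p.map q).sum) hfin hSne
  refine ⟨p, hp, hnd, fun x hx => ?_⟩
  rw [dotProduct_walkFlow]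
  set m := (p.map q).sum
  -- Walks may start anywhere, so that every vertex has a finite potential; the initial charge for
  -- starting off the origin is so large that such walks cannot undercut `m` at the destination.
  let init : V → ℝ := fun u => if u = N.origin then 0 else |m| + ∑ a, |q a|
  let vals : V → Set ℝ := fun v => {c | ∃ u r, N.IsWalk u r v ∧ c = init u + (r.map q).sum}
  have hcharge : ∀ u, 0 ≤ init u := fun u => by
    dsimp only [init]; split_ifs <;> positivity
  have hbdd : ∀ v, BddBelow (vals v) := fun v => by
    refine ⟨-∑ a, |q a|, ?_⟩
    rintro c ⟨u, r, hr, rfl⟩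
    obtain ⟨s, -, h2, h3⟩ := hr.exists_simple_le hcyc
    have := neg_sum_abs_le_of_nodup q (nodup_of_nodup_heads h2)
    linarith [hcharge u]
  have hne : ∀ v, (vals v).Nonempty := fun v => ⟨_, v, [], rfl, rfl⟩
  have hpot : ∀ a, sInf (vals (N.head a)) ≤ sInf (vals (N.tail a)) + q a := fun a => by
    rw [← sub_le_iff_le_add]
    refine le_csInf (hne _) ?_
    rintro c ⟨u, r, hr, rfl⟩
    have := csInf_le (hbdd (N.head a)) ⟨u, r ++ [a], hr.append ⟨rfl, rfl⟩, rfl⟩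
    simp only [List.map_append, List.sum_append, List.map_cons, List.map_nil, List.sum_cons,
      List.sum_nil] at this
    linarith
  have horigin : sInf (vals N.origin) ≤ 0 :=
    csInf_le (hbdd _) ⟨N.origin, [], rfl, by simp [init]⟩
  have hdest : m ≤ sInf (vals N.dest) := by
    refine le_csInf (hne _) ?_
    rintro c ⟨u, r, hr, rfl⟩
    obtain ⟨s, h1, h2, h3⟩ := hr.exists_simple_le hcyc
    by_cases hu : u = N.origin
    · subst hu
      have := hmin s ⟨h1, h2⟩
      simp only [init, if_true]
      linarith
    · have := neg_sum_abs_le_of_nodup q (nodup_of_nodup_heads h2)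
      simp only [init, if_neg hu]
      linarith [le_abs_self m]
  have := potential_le_dotProduct (π := fun v => sInf (vals v)) hpot hx
  linarith

/-! ### Simple paths are extreme points -/

/-- No nonzero circulation is supported on a simple path: the first arc is the only arc of the path
at the start vertex, so it carries nothing, and induction removes it. -/
theorem IsWalk.circulation_eq_zero [Fintype A] {N : TollNetwork V A} {p : List A}
    {u v : V} (h : N.IsWalk u p v) (hnd : (u :: p.map N.head).Nodup) {y : A → ℝ}
    (hy : N.incidence *ᵥ y = 0) (hsupp : ∀ a, a ∉ p → y a = 0) : y = 0 := by
  induction p generalizing u with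
  | nil => ext a; exact hsupp a List.not_mem_nil
  | cons a p ih =>
    obtain ⟨hu, hnd'⟩ := List.nodup_cons.1 hnd
    refine ih h.2 hnd' fun b hb => ?_
    by_cases hba : b = a
    · subst hba
      have hrow := congrFun hy u
      rw [Matrix.mulVec, dotProduct, Finset.sum_eq_single b] at hrow
      · have : N.head b ≠ u := fun e => hu (by simp [e])
        simpa [incidence, h.1, this] using hrow
      · intro c _ hcb
        by_cases hc : c ∈ p
        · have h1 : N.tail c ≠ u := fun e => hu (e ▸ h.2.tail_mem hc)
          have h2 : N.head c ≠ u := fun e =>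
            hu (e ▸ List.mem_cons_of_mem _ (List.mem_map_of_mem hc))
          simp [incidence, h1, h2]
        · rw [hsupp c (by simp [hcb, hc]), mul_zero]
      · simp
    · exact hsupp b (by simp [hba, hb])

/-- The indicator vector of a simple path is an extreme point of the feasible polyhedron. -/
theorem indicator_mem_extremePoints [DecidableEq A] [Fintype A] {N : TollNetwork V A}
    {p : List A} (h : N.IsWalk N.origin p N.dest) (hnd : (N.origin :: p.map N.head).Nodup) :
    walkFlow p ∈ Set.extremePoints ℝ N.feasible := by
  refine ⟨h.walkFlow_mem_feasible, ?_⟩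
  rintro y hy z hz ⟨s, r, hs, hr, -, heq⟩
  have hcirc : N.incidence *ᵥ (y - walkFlow p) = 0 := by
    rw [Matrix.mulVec_sub, hy.1, h.walkFlow_mem_feasible.1, sub_self]
  refine sub_eq_zero.1 (h.circulation_eq_zero hnd hcirc fun a ha => ?_)
  have h0 : walkFlow p a = 0 := by simp [walkFlow, List.count_eq_zero_of_not_mem ha]
  have h1 := congrFun heq a
  simp only [Pi.add_apply, Pi.smul_apply, smul_eq_mul, h0] at h1
  have h2 : 0 ≤ y a := hy.2 a
  have h3 : 0 ≤ r * z a := mul_nonneg hr.le (hz.2 a)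
  have h4 : 0 ≤ s * y a := mul_nonneg hs.le h2
  have h5 : s * y a = 0 := by linarith
  have h6 : y a = 0 := (mul_eq_zero.1 h5).resolve_left hs.ne'
  simp [h0, h6]

/-! ### The follower's cost and its conjugate -/

section Conjugate

variable [Fintype A] {N : TollNetwork V A}

theorem followerCost_le {x : A → ℝ} (hx : x ∈ N.feasible) (t : N.Tolled → ℝ) :
    N.followerCost t ≤ ((N.cost ⬝ᵥ x + t ⬝ᵥ N.reduced x : ℝ) : EReal) := by
  unfold followerCost
  split_ifs with ht
  · exact iInf_le_of_le (N.reduced x) (iInf_le_of_le x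
      (iInf_le_of_le ⟨hx, fun a => hx.2 a, le_rfl⟩ le_rfl))
  · exact bot_le

theorem mem_epi_conjugateCost {w : N.Tolled → ℝ} {z : ℝ} :
    (w, z) ∈ epi N.conjugateCost ↔
      ∀ t, N.followerCost t ≤ ((z + t ⬝ᵥ w : ℝ) : EReal) := by
  simp only [epi, Set.mem_ofPred_eq, conjugateCost, iSup_le_iff]
  refine forall_congr' fun t => ?_
  rw [EReal.sub_le_iff_le_add (Or.inl (EReal.coe_ne_bot _)) (Or.inl (EReal.coe_ne_top _)),
    EReal.coe_add]

/-- The epigraph of the conjugate is closed under increasing both coordinates; for the first one,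
this is because `f` is `-∞` at tolls that are not nonnegative. -/
theorem epi_conjugateCost_mono {w w' : N.Tolled → ℝ} {z z' : ℝ}
    (h : (w, z) ∈ epi N.conjugateCost) (hw : w ≤ w') (hz : z ≤ z') :
    (w', z') ∈ epi N.conjugateCost := by
  rw [mem_epi_conjugateCost] at h ⊢
  intro t
  by_cases ht : 0 ≤ t
  · refine (h t).trans (EReal.coe_le_coe_iff.2 ?_)
    exact add_le_add hz (dotProduct_le_dotProduct_of_nonneg_left hw ht)
  · simp [followerCost, ht]

/-- If a feasible `x` minimizes `cᵀ x + tᵀ x_{A₁}`, then this minimum is `f t`. -/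
theorem followerCost_eq_of_isMin {x : A → ℝ} (hx : x ∈ N.feasible) {t : N.Tolled → ℝ}
    (ht : 0 ≤ t) (hmin : ∀ y ∈ N.feasible,
      N.cost ⬝ᵥ x + t ⬝ᵥ N.reduced x ≤ N.cost ⬝ᵥ y + t ⬝ᵥ N.reduced y) :
    N.followerCost t = ((N.cost ⬝ᵥ x + t ⬝ᵥ N.reduced x : ℝ) : EReal) := by
  refine le_antisymm (followerCost_le hx t) ?_
  rw [followerCost, if_pos ht]
  refine le_iInf fun w => le_iInf fun y => le_iInf fun ⟨hy, _, hyw⟩ => EReal.coe_le_coe_iff.2 ?_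
  exact (hmin y hy).trans
    (add_le_add le_rfl (dotProduct_le_dotProduct_of_nonneg_left hyw ht))

/-- A feasible `x` that minimizes `cᵀ x + tᵀ x_{A₁}` for some `t ≥ 0` is bilevel feasible: its
hyperplane touches `epi (-f)` above `t`. -/
theorem bilevelFeasible_of_isMin {x : A → ℝ} (hx : x ∈ N.feasible) {t : N.Tolled → ℝ}
    (ht : 0 ≤ t) (hmin : ∀ y ∈ N.feasible,
      N.cost ⬝ᵥ x + t ⬝ᵥ N.reduced x ≤ N.cost ⬝ᵥ y + t ⬝ᵥ N.reduced y) :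
    N.BilevelFeasible x := by
  refine ⟨hx, ?_, (t, -N.cost ⬝ᵥ x - t ⬝ᵥ N.reduced x), ?_, ?_⟩
  · rintro ⟨t', z⟩ h
    have h1 : -N.followerCost t' ≤ (z : EReal) := h
    have h2 := (EReal.neg_le_neg_iff.2 (followerCost_le hx t')).trans h1
    rw [← EReal.coe_neg, EReal.coe_le_coe_iff] at h2
    show -(N.cost ⬝ᵥ x) - t' ⬝ᵥ N.reduced x ≤ z
    linarith
  · show -N.followerCost t ≤ _
    rw [followerCost_eq_of_isMin hx ht hmin, ← EReal.coe_neg, EReal.coe_le_coe_iff, neg_dotProduct]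
    simp only
    linarith
  · show -N.cost ⬝ᵥ x - t ⬝ᵥ N.reduced x = -(N.cost ⬝ᵥ x) - t ⬝ᵥ N.reduced x
    rw [neg_dotProduct]

/-- The costs perceived by the follower: tolls are added on the tolled arcs. -/
noncomputable def tolledCost [DecidableEq A] (N : TollNetwork V A) (t : N.Tolled → ℝ) : A → ℝ :=
  fun a => N.cost a + if h : a ∈ N.tolled then t ⟨a, h⟩ else 0

omit [DecidableEq V] in
theorem tolledCost_dotProduct [DecidableEq A] (t : N.Tolled → ℝ) (x : A → ℝ) :
    N.tolledCost t ⬝ᵥ x = N.cost ⬝ᵥ x + t ⬝ᵥ N.reduced x := by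
  simp only [dotProduct, tolledCost, add_mul, Finset.sum_add_distrib, reduced]
  congr 1
  rw [← Finset.sum_subset (Finset.subset_univ N.tolled), ← Finset.sum_attach]
  · exact Finset.sum_congr rfl fun a _ => by simp [a.2]
  · intro a _ ha
    simp [ha]

/-- The functional exposing a non-vertical face of `epi g` is, up to a positive factor `s`, of the
form `(w, z) ↦ -(z + τᵀ w)` with `τ ≥ 0`. -/
theorem exists_toll_of_isReactionSet {W : Set (N.Tolled → ℝ)} (hW : N.IsReactionSet W) :
    ∃ τ : N.Tolled → ℝ, 0 ≤ τ ∧ ∃ K : ℝ,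
      (∀ w z, (w, z) ∈ epi N.conjugateCost → K ≤ z + τ ⬝ᵥ w) ∧
      ∀ w z, (w, z) ∈ epi N.conjugateCost → (∀ w' z', (w', z') ∈ epi N.conjugateCost →
        z + τ ⬝ᵥ w ≤ z' + τ ⬝ᵥ w') → w ∈ W := by
  classical
  obtain ⟨F, ⟨hFne, hF⟩, hvert, rfl⟩ := hW
  obtain ⟨l, rfl⟩ := hF hFne
  obtain ⟨⟨w₀, z₀⟩, hmem, hmax⟩ := hFne
  set s : ℝ := -l (0, 1) with hs
  have hl : ∀ w z, l (w, z) = ∑ a, w a * l (Pi.single a 1, 0) - s * z := fun w z => by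
    have h1 : ((w, z) : (N.Tolled → ℝ) × ℝ)
        = ∑ a, w a • ((Pi.single a 1, 0) : (N.Tolled → ℝ) × ℝ) + z • (0, 1) := by
      refine Prod.ext ?_ ?_
      · simp only [Prod.fst_add, Prod.fst_sum, Prod.smul_fst, smul_zero, add_zero]
        exact pi_eq_sum_univ' w
      · simp [Prod.snd_sum]
    rw [h1, map_add, map_sum]
    simp only [map_smul, smul_eq_mul, hs]
    ring
  have hs0 : 0 ≤ s := by
    have := hmax _ (epi_conjugateCost_mono hmem le_rfl (z' := z₀ + 1) (by linarith))
    rw [hl, hl] at this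
    linarith
  have hspos : 0 < s := by
    refine lt_of_le_of_ne hs0 fun h0 => hvert ?_
    -- With `s = 0` the face would contain the vertical segment above `(w₀, z₀)`.
    have hmem' := epi_conjugateCost_mono hmem le_rfl (z' := z₀ + 1) (by linarith)
    have hin : (w₀, z₀ + 1) ∈ {x ∈ epi N.conjugateCost | ∀ y ∈ epi N.conjugateCost, l y ≤ l x} := by
      refine ⟨hmem', fun y hy => (hmax y hy).trans ?_⟩
      rw [hl, hl, ← h0]
      simp
    have := vsub_mem_vectorSpan ℝ hin ⟨hmem, hmax⟩
    rw [direction_affineSpan]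
    simpa using this
  have hτ : ∀ a, l (Pi.single a 1, 0) ≤ 0 := fun a => by
    have h1 : w₀ ≤ w₀ + Pi.single a 1 := le_add_of_nonneg_right (by simp)
    have h2 := hmax _ (epi_conjugateCost_mono hmem h1 le_rfl)
    have h3 : ((w₀ + Pi.single a 1, z₀) : (N.Tolled → ℝ) × ℝ) = (w₀, z₀) + (Pi.single a 1, 0) := by
      simp
    rw [h3, map_add] at h2
    linarith
  let τ : N.Tolled → ℝ := fun a => -l (Pi.single a 1, 0) / s
  have hlτ : ∀ w z, l (w, z) = -s * (z + τ ⬝ᵥ w) := fun w z => by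
    have : s * (τ ⬝ᵥ w) = -∑ a, w a * l (Pi.single a 1, 0) := by
      rw [dotProduct, Finset.mul_sum, ← Finset.sum_neg_distrib]
      refine Finset.sum_congr rfl fun a _ => ?_
      simp only [τ]
      field_simp
    rw [hl]
    linarith
  refine ⟨τ, fun a => div_nonneg (neg_nonneg.2 (hτ a)) hs0, z₀ + τ ⬝ᵥ w₀, ?_, ?_⟩
  · intro w z h
    have := hmax _ h
    rw [hlτ, hlτ] at this
    nlinarith
  · intro w z h hle
    refine ⟨z, h, ?_⟩
    rintro ⟨w', z'⟩ h'
    rw [hlτ, hlτ]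
    nlinarith [hle w' z' h']

end Conjugate

end TollNetwork

theorem mainTheorem7 {V A : Type*} [Fintype V] [DecidableEq V] [Fintype A] [DecidableEq A]
    (N : TollNetwork V A)
    (hcost : ∀ a, a ∉ N.tolled → 0 ≤ N.cost a)
    (hfree : N.HasTollFreePath)
    (w : N.Tolled → ℝ) (hw : N.StronglyBilevelFeasible w) :
    (∃ x ∈ Set.extremePoints ℝ N.feasible,
      N.IsSimplePath x ∧ N.BilevelFeasible x ∧ N.reduced x = w) ∧
    ∀ a, w a = 0 ∨ w a = 1 := by
  open TollNetwork in
  obtain ⟨τ, hτ, K, hK, hface⟩ := exists_toll_of_isReactionSet hw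
  obtain ⟨p₀, hp₀, -⟩ := hfree
  have hepi : ∀ x ∈ N.feasible, (N.reduced x, N.cost ⬝ᵥ x) ∈ epi N.conjugateCost :=
    fun x hx => mem_epi_conjugateCost.2 (followerCost_le hx)
  obtain ⟨p, hp, hnd, hmin⟩ := exists_simplePath_isMin (q := N.tolledCost τ) (K := K)
    (fun x hx => by rw [tolledCost_dotProduct]; exact hK _ _ (hepi x hx)) hp₀
  simp only [tolledCost_dotProduct] at hmin
  have hx := hp.walkFlow_mem_feasible
  have hind := walkFlow_of_nodup (nodup_of_nodup_heads hnd)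
  have hred : N.reduced (walkFlow p) = w := by
    refine hface _ _ (hepi _ hx) fun w' z' h' => ?_
    have := mem_epi_conjugateCost.1 h' τ
    rwa [followerCost_eq_of_isMin hx hτ hmin, EReal.coe_le_coe_iff] at this
  refine ⟨⟨walkFlow p, indicator_mem_extremePoints hp hnd, ⟨p, hp, hnd, hind⟩,
    bilevelFeasible_of_isMin hx hτ hmin, hred⟩, fun a => ?_⟩
  rw [← hred, reduced, hind]
  split_ifs <;> simp
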